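/- Setting. Let $G=NH$ be a (real, finite-dimensional) Lie group, where $N,H$ are closed connected subgroups with $N\cap H=\{1\}$, and $N$ is normal in $G$ and is an exponential solvable Lie group: its Lie algebra $\mathfrak n$ is solvable and $\exp:\mathfrak n\to N$ is a diffeomorphism, with inverse $\log$. Let $\mu_H$ be a left Haar measure on $H$, let $\mathfrak h$ be the Lie algebra of $H$, and let $\lambda\in\mathfrak n^*$ vanish on $[\mathfrak n,\mathfrak n]$. Put $\beta_\lambda(h)=Ad(h^{-1})^*\lambda\in\mathfrak n^*$ for $h\in H$, and let $\pi=\mathrm{ind}_N^{NH}(\chi_\lambda)$, where $\chi_\lambda(\exp X)=e^{2\pi i\langle\lambda,X\rangle}$, be the induced representation of $G$ realized on $L^2(H,d\mu_H)$ by $$[\pi(x)f](h)=e^{2\pi i\langle \beta_\lambda(h),\log x\rangle}f(h)\quad(x\in N),\qquad [\pi(z)f](h)=f(z^{-1}h)\quad(z\in H).$$ Let $X_1,\dots,X_n$ be a basis of $\mathfrak n$ with dual basis $X_1^*,\dots,X_n^*$, let $J\subseteq\{1,\dots,n\}$, and let $P:\mathfrak n\to\mathfrak n$ be the projection with $PX_k=X_k$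 for $k\in J$ and $PX_k=0$ for $k\notin J$. Put $\mathfrak p=P(\mathfrak n)$ and $\mathfrak p^*=P^*(\mathfrak n^*)=\bigoplus_{j\in J}\mathbb R X_j^*\simeq\mathbb R^{J}$, with Lebesgue measure $d\xi$ and $|E|$ the Lebesgue measure of $E\subseteq\mathfrak p^*$. Let $\varphi:\mathcal O\to\varphi(\mathcal O)\subseteq\mathfrak h$ be a smooth chart of $H$ on an open neighbourhood $\mathcal O$ of the identity, with $\varphi(1)=0$, such that $$\Theta_\lambda=P^*\beta_\lambda\varphi^{-1}:\varphi(\mathcal O)\to\Theta_\lambda(\varphi(\mathcal O))\subseteq\mathfrak p^*$$ is a diffeomorphism onto an open set. Let $\mathbf W_\lambda(\xi)=\dfrac{d\mu_H(\varphi^{-1}(\Theta_\lambda^{-1}(\xi)))}{d\xi}$ be the Radon–Nikodym derivative, with respect to $d\xi$, of the push-forward of $\mu_H|_{\mathcal O}$ under $\Theta_\lambda\circ\varphi$. Assume: (i) $C\subset\mathfrak p^*$ is compact with $\Theta_\lambda(\varphi(\mathcal O))\subseteq C$, and $\Gamma_N\subset\exp(\mathfrak p)$ is a discrete set such that $\left\{|C|^{-1/2}e^{2\pi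 i\langle\xi,Y\rangle}:Y\in\log\Gamma_N\right\}$ is an orthonormal basis of $L^2(C,d\xi)$; (ii) $\Gamma_H\subset H$ is a discrete set such that $\{\ell^{-1}\mathcal O:\ell\in\Gamma_H\}$ is a tiling of $H$, that is, these sets cover $H$ and are pairwise disjoint, up to sets of $\mu_H$-measure zero; (iii) $\mathbf f$ is the function on $H$ that vanishes off $\mathcal O$ and satisfies $\mathbf f(\varphi^{-1}(\Theta_\lambda^{-1}(\xi)))=\mathbf W_\lambda(\xi)^{-1/2}$ for $\xi\in\Theta_\lambda(\varphi(\mathcal O))$ (almost everywhere). Proposition. Then $\mathbf f\in L^2(H,d\mu_H)$, and: 1. $\left\{\pi(\ell^{-1}\kappa)\,|C|^{-1/2}\mathbf f:\ell\in\Gamma_H,\ \kappa\in\Gamma_N\right\}$ is a Parseval frame for $L^2(H,d\mu_H)$, i.e. $\sum_{\ell,\kappa}|\langle \mathbf g,\pi(\ell^{-1}\kappa)|C|^{-1/2}\mathbf f\rangle|^2=\|\mathbf g\|^2$ for all $\mathbf g\in L^2(H,d\mu_H)$. 2. If moreover $\|\mathbf f\|_{L^2(H,d\mu_H)}=|C|^{1/2}$,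 then this system is an orthonormal basis of $L^2(H,d\mu_H)$. -/

import Mathlib

open MeasureTheory
open scoped Manifold ContDiff ENNReal

noncomputable section

namespace LieFrame

/-! ### Lie groups: exponential map, exponential groups -/

/-- A `C^∞` real Lie group has the smoothness needed for its Lie bracket. -/
instance lieGroupMinSmoothness {E : Type*} [NormedAddCommGroup E] [NormedSpace ℝ E]
    {K : Type*} [TopologicalSpace K] [ChartedSpace E K] [Group K] [LieGroup 𝓘(ℝ, E) ∞ K] :
    LieGroup 𝓘(ℝ, E) (minSmoothness ℝ 3) K :=
  LieGroup.of_le (n := ∞) (by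
    rw [minSmoothness_of_isRCLikeNormedField]
    exact ENat.LEInfty.out)

/-- `γ : ℝ → K` is the one-parameter subgroup of `K` with velocity `X` at `0`. -/
def IsOneParameterSubgroup {E : Type*} [NormedAddCommGroup E] [NormedSpace ℝ E]
    {K : Type*} [TopologicalSpace K] [ChartedSpace E K] [Group K]
    (X : GroupLieAlgebra 𝓘(ℝ, E) K) (γ : ℝ → K) : Prop :=
  (∀ s t : ℝ, γ (s + t) = γ s * γ t) ∧ ContMDiff 𝓘(ℝ, ℝ) 𝓘(ℝ, E) ∞ γ ∧
    mfderiv 𝓘(ℝ, ℝ) 𝓘(ℝ, E) γ 0 (1 : ℝ) = X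

open Classical in
/-- The exponential map `𝔨 → K` of a Lie group: `exp X = γ 1` for the one-parameter subgroup `γ`
with velocity `X`. -/
def lieExp {E : Type*} [NormedAddCommGroup E] [NormedSpace ℝ E]
    {K : Type*} [TopologicalSpace K] [ChartedSpace E K] [Group K]
    (X : GroupLieAlgebra 𝓘(ℝ, E) K) : K :=
  if h : ∃ γ : ℝ → K, IsOneParameterSubgroup X γ then h.choose 1 else 1

/-- The inverse `log : K → 𝔨` of the exponential map (meaningful when `exp` is bijective). -/
def lieLog {E : Type*} [NormedAddCommGroup E] [NormedSpace ℝ E]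
    {K : Type*} [TopologicalSpace K] [ChartedSpace E K] [Group K] :
    K → GroupLieAlgebra 𝓘(ℝ, E) K :=
  Function.invFun lieExp

/-- `K` is an exponential solvable Lie group: its Lie algebra is solvable and the exponential map
is a global diffeomorphism from the Lie algebra (a copy of the model space `E`) onto `K`. -/
structure IsExponentialSolvable (E : Type*) [NormedAddCommGroup E] [NormedSpace ℝ E]
    [CompleteSpace E]
    (K : Type*) [TopologicalSpace K] [ChartedSpace E K] [Group K] [LieGroup 𝓘(ℝ, E) ∞ K] :
    Prop where
  solvable : LieAlgebra.IsSolvable (GroupLieAlgebra 𝓘(ℝ, E) K)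
  bijective : Function.Bijective (lieExp : GroupLieAlgebra 𝓘(ℝ, E) K → K)
  contMDiff_exp : ContMDiff 𝓘(ℝ, E) 𝓘(ℝ, E) ∞ (fun v : E => lieExp (E := E) (K := K) v)
  contMDiff_log : ContMDiff (M' := E) 𝓘(ℝ, E) 𝓘(ℝ, E) ∞ (fun x : K => lieLog (E := E) x)

/-- The closed subgroup `K` of the Lie group `G`, with its Lie group structure: the topology is the
subspace topology and the inclusion is smooth. (These two properties determine the manifold
structure of `K`.) -/
structure IsClosedLieSubgroup (EG : Type*) [NormedAddCommGroup EG] [NormedSpace ℝ EG]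
    (EK : Type*) [NormedAddCommGroup EK] [NormedSpace ℝ EK]
    {G : Type*} [TopologicalSpace G] [ChartedSpace EG G] [Group G]
    (K : Subgroup G) [ChartedSpace EK K] : Prop where
  isClosed : IsClosed (K : Set G)
  contMDiff_coe : ContMDiff 𝓘(ℝ, EK) 𝓘(ℝ, EG) ∞ (fun x : K => (x : G))

/-! ### Bases and Parseval frames in Hilbert spaces, and for families of functions in `L²` -/

/-- `v` is an orthonormal (Hilbert) basis of `F`. -/
def IsOrthonormalBasis {ι F : Type*} [NormedAddCommGroup F] [InnerProductSpace ℂ F]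
    (v : ι → F) : Prop :=
  ∃ b : HilbertBasis ι ℂ F, ∀ i, b i = v i

/-- `v` is a Parseval frame of `F`: `∑ |⟨g, v_i⟩|² = ‖g‖²` for all `g`. -/
def IsParsevalFrame {ι F : Type*} [NormedAddCommGroup F] [InnerProductSpace ℂ F]
    (v : ι → F) : Prop :=
  ∀ g : F, HasSum (fun i => ‖inner ℂ g (v i)‖ ^ 2) (‖g‖ ^ 2)

/-- The functions `u i` are square integrable and form an orthonormal basis of `L²(ν)`. -/
def IsOrthonormalBasisL2 {ι α : Type*} [MeasurableSpace α] (u : ι → α → ℂ) (ν : Measure α) :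
    Prop :=
  ∃ hu : ∀ i, MemLp (u i) 2 ν, IsOrthonormalBasis (fun i => (hu i).toLp (u i))

/-- The functions `u i` are square integrable and form a Parseval frame of `L²(ν)`. -/
def IsParsevalFrameL2 {ι α : Type*} [MeasurableSpace α] (u : ι → α → ℂ) (ν : Measure α) :
    Prop :=
  ∃ hu : ∀ i, MemLp (u i) 2 ν, IsParsevalFrame (fun i => (hu i).toLp (u i))

/-! ### Coordinate projections of `𝔫` and the space `𝔭*` -/

section Projection

variable {n : ℕ} {V : Type*} [AddCommGroup V] [Module ℝ V]

/-- The projection `P = P_J` of `V` with `P X_k = X_k` for `k ∈ J` and `P X_k = 0` otherwise. -/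
def proj (X : Module.Basis (Fin n) ℝ V) (J : Finset (Fin n)) : V →ₗ[ℝ] V :=
  X.constr ℝ (fun k => if k ∈ J then X k else 0)

/-- The identification `ℝ^J ≃ 𝔭* = P*(V*)`, `ξ ↦ ∑_{j ∈ J} ξ_j X_j^*`. -/
def dualVec (X : Module.Basis (Fin n) ℝ V) (J : Finset (Fin n)) (ξ : J → ℝ) : Module.Dual ℝ V :=
  ∑ j : J, ξ j • X.coord j

/-- The coordinates of a functional with respect to the dual basis vectors `X_j^*`, `j ∈ J`;
on `𝔭*` this is the inverse of `dualVec`. -/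
def dualCoord (X : Module.Basis (Fin n) ℝ V) (J : Finset (Fin n)) (η : Module.Dual ℝ V) : J → ℝ :=
  fun j => η (X j)

end Projection

/-- The function `u` is a `C^∞` diffeomorphism from the open set `U` onto an open set. -/
def IsDiffeoOn {E F : Type*} [NormedAddCommGroup E] [NormedSpace ℝ E] [NormedAddCommGroup F]
    [NormedSpace ℝ F] (u : E → F) (U : Set E) : Prop :=
  ∃ e : OpenPartialHomeomorph E F, e.source = U ∧ Set.EqOn e u U ∧
    ContDiffOn ℝ ∞ e e.source ∧ ContDiffOn ℝ ∞ e.symm e.target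

/-! ### The group `G = NH`, the coadjoint orbit map, and the induced representation -/

section Group

variable {EN EH : Type*} [NormedAddCommGroup EN] [NormedSpace ℝ EN]
  [NormedAddCommGroup EH] [NormedSpace ℝ EH]
  {G : Type*} [TopologicalSpace G] [Group G]
  {N H : Subgroup G} [N.Normal] [ChartedSpace EN N] [ChartedSpace EH H]

/-- `Ad(h)` on `𝔫`: the differential at the identity of `x ↦ h x h⁻¹` on the normal subgroup. -/
def Ad (h : H) : GroupLieAlgebra 𝓘(ℝ, EN) N →L[ℝ] GroupLieAlgebra 𝓘(ℝ, EN) N :=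
  mfderiv 𝓘(ℝ, EN) 𝓘(ℝ, EN) (fun x : N => MulAut.conjNormal (h : G) x) 1

/-- `β_lam(h) = Ad(h⁻¹)^* lam`. -/
def beta (lam : Module.Dual ℝ (GroupLieAlgebra 𝓘(ℝ, EN) N)) (h : H) :
    Module.Dual ℝ (GroupLieAlgebra 𝓘(ℝ, EN) N) :=
  lam ∘ₗ (Ad (h⁻¹) : GroupLieAlgebra 𝓘(ℝ, EN) N →L[ℝ] GroupLieAlgebra 𝓘(ℝ, EN) N).toLinearMap

/-- `Θ_lam = P^* β_lam φ⁻¹`, with values in `𝔭* ≃ ℝ^J`; the Lie algebra of `H` is the model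
space `EH`. -/
def Theta {n : ℕ} (lam : Module.Dual ℝ (GroupLieAlgebra 𝓘(ℝ, EN) N))
    (X : Module.Basis (Fin n) ℝ (GroupLieAlgebra 𝓘(ℝ, EN) N)) (J : Finset (Fin n))
    (φ : OpenPartialHomeomorph H EH) (A : EH) : J → ℝ :=
  dualCoord X J ((proj X J).dualMap (beta lam (φ.symm A)))

/-- The Radon-Nikodym derivative `W_lam(ξ) = dμ(φ⁻¹(Θ_lam⁻¹(ξ))) / dξ` of the push-forward, under
`Θ_lam ∘ φ`, of the restriction of `μ` to `𝒪 = φ.source`, with respect to Lebesgue measure. -/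
def W {n : ℕ} [MeasurableSpace G] (μ : Measure H)
    (lam : Module.Dual ℝ (GroupLieAlgebra 𝓘(ℝ, EN) N))
    (X : Module.Basis (Fin n) ℝ (GroupLieAlgebra 𝓘(ℝ, EN) N)) (J : Finset (Fin n))
    (φ : OpenPartialHomeomorph H EH) : (J → ℝ) → ℝ≥0∞ :=
  ((μ.restrict φ.source).map (fun h => Theta lam X J φ (φ h))).rnDeriv volume

/-- The function on `H` that vanishes off `𝒪 = φ.source` and satisfies
`f(φ⁻¹(Θ_lam⁻¹(ξ))) = W_lam(ξ)^{-1/2}` for `ξ ∈ Θ_lam(φ(𝒪))`. -/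
def window {n : ℕ} [MeasurableSpace G] (μ : Measure H)
    (lam : Module.Dual ℝ (GroupLieAlgebra 𝓘(ℝ, EN) N))
    (X : Module.Basis (Fin n) ℝ (GroupLieAlgebra 𝓘(ℝ, EN) N)) (J : Finset (Fin n))
    (φ : OpenPartialHomeomorph H EH) : H → ℂ :=
  φ.source.indicator
    (fun h => (((W μ lam X J φ (Theta lam X J φ (φ h))).toReal ^ (-(1 / 2) : ℝ) : ℝ) : ℂ))

/-- `π(x)` for `x ∈ N`: `[π(x)f](h) = e^{2πi⟨Ad(h⁻¹)^*lam, log x⟩} f(h)`. -/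
def piN (lam : Module.Dual ℝ (GroupLieAlgebra 𝓘(ℝ, EN) N)) (x : N) (f : H → ℂ) : H → ℂ :=
  fun h => Complex.exp (2 * Real.pi * Complex.I * (beta lam h (lieLog x) : ℝ)) * f h

/-- `π(z)` for `z ∈ H`: `[π(z)f](h) = f(z⁻¹h)`. -/
def piH (z : H) (f : H → ℂ) : H → ℂ := fun h => f (z⁻¹ * h)

/-- The induced representation `π = ind_N^{NH}(χ_lam)` of `G = NH = HN`: writing `g = z x` with
unique `z ∈ H`, `x ∈ N`, one has `π(g) = π(z) π(x)`. -/
def indRep (hG : Subgroup.IsComplement' N H) (lam : Module.Dual ℝ (GroupLieAlgebra 𝓘(ℝ, EN) N))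
    (g : G) (f : H → ℂ) : H → ℂ :=
  piH (hG.symm.equiv g).1 (piN lam (hG.symm.equiv g).2 f)

/-- The trigonometric system `ℰ(C, Γ_N)`: for `κ ∈ Γ_N` the function
`ξ ↦ |C|^{-1/2} e^{2πi⟨ξ, log κ⟩}` on `𝔭* ≃ ℝ^J`. -/
def trigSystem {n : ℕ} (X : Module.Basis (Fin n) ℝ (GroupLieAlgebra 𝓘(ℝ, EN) N))
    (J : Finset (Fin n)) (C : Set (J → ℝ)) (ΓN : Set N) (κ : ΓN) (ξ : J → ℝ) : ℂ :=
  Complex.exp (2 * Real.pi * Complex.I * (dualVec X J ξ (lieLog (κ : N)) : ℝ)) /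
    (Real.sqrt (volume.real C) : ℂ)

/-- The translates `ℓ⁻¹ U`, `ℓ ∈ Γ`, tile `H`: they cover `H` and are pairwise disjoint, up to
sets of measure zero. -/
def Tiles {K : Type*} [Group K] [MeasurableSpace K] (μ : Measure K) (Γ U : Set K) : Prop :=
  (Γ.Pairwise fun ℓ ℓ' => μ (((fun h => ℓ⁻¹ * h) '' U) ∩ ((fun h => ℓ'⁻¹ * h) '' U)) = 0) ∧
    μ (⋃ ℓ ∈ Γ, (fun h => ℓ⁻¹ * h) '' U)ᶜ = 0

/-- The system `𝒮(|C|^{-1/2} f, Γ_H⁻¹ Γ_N) = {π(ℓ⁻¹ κ) (|C|^{-1/2} f)}`, indexed by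
`(ℓ, κ) ∈ Γ_H × Γ_N`. -/
def frameSystem {n : ℕ} (hG : Subgroup.IsComplement' N H)
    (lam : Module.Dual ℝ (GroupLieAlgebra 𝓘(ℝ, EN) N)) {J : Finset (Fin n)} (C : Set (J → ℝ))
    (ΓH : Set H) (ΓN : Set N) (f : H → ℂ) (i : ΓH × ΓN) : H → ℂ :=
  indRep hG lam (((i.1 : H)⁻¹ : H) * ((i.2 : N) : G))
    (fun h => (((volume.real C) ^ (-(1 / 2) : ℝ) : ℝ) : ℂ) * f h)

end Group

end LieFrame

end

namespace LieFrame

/-! ### Absolute continuity of Haar measure in smooth charts -/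

/-! The composite `ψ = Θ_lam ∘ φ` is a smooth chart of `H` on `𝒪`. It pushes `μ|𝒪` to a measure `ν`
carried by `C` and, by `map_restrict_absolutelyContinuous`, with a density `W = w²` for Lebesgue
measure. Since `log κ ∈ 𝔭`, the phase of `π(κ)` at `h ∈ 𝒪` is `⟨ψ h, log κ⟩`, so `|C|^{-1/2} π(κ) f`
equals `(e_κ / w) ∘ ψ` on `𝒪` and vanishes elsewhere, `e_κ` being the trigonometric system.

Write `g = K ∘ ψ` on `𝒪`. Pairing `g` with these functions gives `∫ ⟨K, e_κ / w⟩ dν = ∫_C ⟨w K, e_κ⟩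
dξ`, and Parseval on `C` sums the squares to `∫_C |w K|² dξ = ∫_𝒪 |g|² dμ`
(`hasSum_norm_sq_integral_chart`). Left translations by `Γ_H` carry this to every tile `ℓ⁻¹𝒪`, and
the tiles add up to `‖g‖²` (`isParsevalFrameL2_of_tiles`).

Translations and phases preserve norms, so the condition on `‖f‖` makes every frame vector a unit
vector, and a Parseval frame of unit vectors is an orthonormal basis. -/

theorem measurableSet_source_inter_preimage {α β : Type*} [TopologicalSpace α] [MeasurableSpace α]
    [BorelSpace α] [TopologicalSpace β] [MeasurableSpace β] [BorelSpace β]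
    (ψ : OpenPartialHomeomorph α β) {E : Set β} (hE : MeasurableSet E) :
    MeasurableSet (ψ.source ∩ ψ ⁻¹' E) := by
  have h : Measurable (fun x : ψ.source => ψ x) :=
    (continuousOn_iff_continuous_domRestrict.mp ψ.continuousOn).measurable
  have := (MeasurableEmbedding.subtype_coe ψ.open_source.measurableSet).measurableSet_image.mpr
    (h hE)
  convert this using 1
  ext x
  simp [and_comm]

/-- A left Haar measure on a Lie group is absolutely continuous in every smooth chart. -/
theorem map_restrict_absolutelyContinuous {E F : Type*} [NormedAddCommGroup E] [NormedSpace ℝ E]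
    [NormedAddCommGroup F] [NormedSpace ℝ F] [FiniteDimensional ℝ F]
    [MeasurableSpace F] [BorelSpace F] (ρ : Measure F) [ρ.IsAddHaarMeasure]
    {K : Type*} [TopologicalSpace K] [SecondCountableTopology K] [ChartedSpace E K] [Group K]
    [LieGroup 𝓘(ℝ, E) ∞ K] [MeasurableSpace K] [BorelSpace K]
    (μ : Measure K) [SFinite μ] [μ.IsMulLeftInvariant]
    (ψ : OpenPartialHomeomorph K F) (hψ : ContMDiffOn 𝓘(ℝ, E) 𝓘(ℝ, F) ∞ ψ ψ.source)
    (hψ' : ContMDiffOn 𝓘(ℝ, F) 𝓘(ℝ, E) ∞ ψ.symm ψ.target) :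
    (μ.restrict ψ.source).map ψ ≪ ρ := by
  classical
  have : IsTopologicalGroup K := topologicalGroup_of_lieGroup 𝓘(ℝ, E) ∞
  refine Measure.AbsolutelyContinuous.mk fun B hB hρB => ?_
  rw [Measure.map_apply_of_aemeasurable
      (ψ.continuousOn.aemeasurable ψ.open_source.measurableSet) hB,
    Measure.restrict_apply' ψ.open_source.measurableSet, Set.inter_comm]
  set A := ψ.source ∩ ψ ⁻¹' B with hA
  have hAm : MeasurableSet A := measurableSet_source_inter_preimage ψ hB
  rcases ψ.target.eq_empty_or_nonempty with h0 | hne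
  · have : ψ.source = ∅ := by
      by_contra h
      obtain ⟨x, hx⟩ := Set.nonempty_iff_ne_empty.mpr h
      exact (h0 ▸ ψ.map_source hx : ψ x ∈ (∅ : Set F))
    simp [hA, this]
  -- The inverse chart is extended by a constant to be measurable on all of `F`; the values off the
  -- target are invisible to `ρ.restrict ψ.target`.
  have hSm : Measurable (ψ.target.piecewise ψ.symm (fun _ => (1 : K))) :=
    ψ.continuousOn_symm.measurable_piecewise continuousOn_const ψ.open_target.measurableSet
  set S := ψ.target.piecewise ψ.symm (fun _ => (1 : K)) with hS
  have hSeq : ∀ x ∈ ψ.target, S x = ψ.symm x := fun x hx => Set.piecewise_eq_of_mem _ _ _ hx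
  -- Each slice is the image of part of the null set `B` under the transition map `y ↦ ψ (h⁻¹ *
  -- ψ.symm y)`, and differentiable maps between spaces of equal dimension preserve null sets.
  have key : ∀ h : K, (ρ.restrict ψ.target) {x | h * S x ∈ A} = 0 := by
    intro h
    rw [Measure.restrict_apply' ψ.open_target.measurableSet]
    have hd : DifferentiableOn ℝ (fun y => ψ (h⁻¹ * ψ.symm y))
        {y ∈ ψ.target | h⁻¹ * ψ.symm y ∈ ψ.source} := by
      have h1 : ContMDiffOn 𝓘(ℝ, F) 𝓘(ℝ, E) ∞ (fun y => h⁻¹ * ψ.symm y) ψ.target :=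
        (contMDiff_mul_left (I := 𝓘(ℝ, E)) (n := ∞) (a := h⁻¹)).comp_contMDiffOn hψ'
      have h2 : ContMDiffOn 𝓘(ℝ, F) 𝓘(ℝ, F) ∞ (fun y => ψ (h⁻¹ * ψ.symm y))
          {y ∈ ψ.target | h⁻¹ * ψ.symm y ∈ ψ.source} :=
        hψ.comp (h1.mono fun y hy => hy.1) fun y hy => hy.2
      exact h2.contDiffOn.differentiableOn (by simp)
    have himg := addHaar_image_eq_zero_of_differentiableOn_of_addHaar_eq_zero ρ
      (hd.mono (Set.inter_subset_left (t := B))) (measure_mono_null Set.inter_subset_right hρB)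
    refine measure_mono_null ?_ himg
    rintro x ⟨hx, hxt⟩
    rw [Set.mem_ofPred_eq, hSeq x hxt] at hx
    exact ⟨ψ (h * ψ.symm x), ⟨⟨ψ.map_source hx.1, by
      simpa [ψ.left_inv hx.1] using ψ.map_target hxt⟩, hx.2⟩, by
      simp [ψ.left_inv hx.1, ψ.right_inv hxt]⟩
  have hDm : MeasurableSet {p : K × F | p.1 * S p.2 ∈ A} :=
    (measurable_fst.mul (hSm.comp measurable_snd)) hAm
  have hnull : (μ.prod (ρ.restrict ψ.target)) {p : K × F | p.1 * S p.2 ∈ A} = 0 :=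
    Measure.measure_prod_null_of_ae_null hDm (.of_forall key)
  -- Fubini in the other order: for almost every `x` in the target, the right translate `{h | h * S
  -- x ∈ A}` is `μ`-null. One such `x` suffices, because right translation preserves the null sets
  -- of a left-invariant measure.
  rw [Measure.prod_apply_symm hDm, lintegral_eq_zero_iff (measurable_measure_prodMk_right hDm)]
    at hnull
  have : (ae (ρ.restrict ψ.target)).NeBot := by
    rw [ae_neBot, Ne, Measure.restrict_eq_zero]
    exact (ψ.open_target.measure_pos ρ hne).ne'
  obtain ⟨x, hx⟩ := hnull.exists
  exact (measure_mul_right_null μ (S x)).mp hx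

/-! ### Parseval frames and orthonormal bases -/

section Hilbert

variable {ι F : Type*} [NormedAddCommGroup F] [InnerProductSpace ℂ F]

theorem IsOrthonormalBasis.isParsevalFrame {v : ι → F} (hv : IsOrthonormalBasis v) :
    IsParsevalFrame v := by
  obtain ⟨b, hb⟩ := hv
  intro g
  have h := b.hasSum_inner_mul_inner g g
  rw [inner_self_eq_norm_sq_to_K] at h
  have h2 := Complex.hasSum_re h
  convert h2 using 1
  · funext i
    rw [← hb i, ← inner_conj_symm (b i) g, Complex.mul_conj, Complex.ofReal_re,
      Complex.normSq_eq_norm_sq]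
  · norm_cast

/-- A Parseval frame of unit vectors is an orthonormal basis. -/
theorem IsParsevalFrame.isOrthonormalBasis [CompleteSpace F] {v : ι → F} (hv : IsParsevalFrame v)
    (h1 : ∀ i, ‖v i‖ = 1) : IsOrthonormalBasis v := by
  classical
  have hon : Orthonormal ℂ v := by
    refine ⟨h1, fun i j hij => ?_⟩
    have hs := hv (v i)
    -- Parseval for `v i` itself: the `i`-th term already exhausts the total `1`, so the `j`-th must
    -- vanish.
    have hle := sum_le_hasSum {i, j} (fun _ _ => by positivity) hs
    rw [Finset.sum_pair hij, inner_self_eq_norm_sq_to_K, h1] at hle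
    have h0 : ‖inner ℂ (v i) (v j)‖ ^ 2 ≤ 0 := by simpa using hle
    simpa using h0.antisymm (by positivity)
  have hsp : (Submodule.span ℂ (Set.range v))ᗮ = ⊥ := by
    rw [Submodule.eq_bot_iff]
    intro g hg
    have h0 : ∀ i, inner ℂ g (v i) = 0 := fun i =>
      Submodule.inner_left_of_mem_orthogonal (Submodule.subset_span (Set.mem_range_self i)) hg
    have hs := hv g
    simp only [h0, norm_zero, ne_eq, OfNat.ofNat_ne_zero, not_false_eq_true, zero_pow] at hs
    simpa using hs.unique hasSum_zero
  exact ⟨HilbertBasis.mkOfOrthogonalEqBot hon hsp, fun i => by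
    rw [HilbertBasis.coe_mkOfOrthogonalEqBot]⟩

theorem hasSum_prod_of_nonneg {α β : Type*} {u : α × β → ℝ} (hu : 0 ≤ u) {s : α → ℝ} {S : ℝ}
    (h : ∀ a, HasSum (fun b => u (a, b)) (s a)) (hs : HasSum s S) : HasSum u S := by
  have hsum : Summable u := (summable_prod_of_nonneg hu).mpr
    ⟨fun a => (h a).summable, by simpa only [(h _).tsum_eq] using hs.summable⟩
  have := hsum.hasSum.prod_fiberwise h
  rw [← this.unique hs]
  exact hsum.hasSum

end Hilbert

/-! ### Square-integrable functions -/

section LTwo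

variable {α : Type*} [MeasurableSpace α] {μ : Measure α}

theorem inner_toLp_eq_integral {u v : α → ℂ} (hu : MemLp u 2 μ) (hv : MemLp v 2 μ) :
    inner ℂ (hu.toLp u) (hv.toLp v) = ∫ x, inner ℂ (u x) (v x) ∂μ := by
  rw [L2.inner_def]
  refine integral_congr_ae ?_
  filter_upwards [hu.coeFn_toLp, hv.coeFn_toLp] with x h1 h2
  rw [h1, h2]

theorem norm_sq_toLp_eq_integral {u : α → ℂ} (hu : MemLp u 2 μ) :
    ‖hu.toLp u‖ ^ 2 = ∫ x, ‖u x‖ ^ 2 ∂μ := by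
  have h : (inner ℂ (hu.toLp u) (hu.toLp u)).re = ‖hu.toLp u‖ ^ 2 := by
    rw [inner_self_eq_norm_sq_to_K]
    norm_cast
  rw [← h, inner_toLp_eq_integral]
  simp_rw [inner_self_eq_norm_sq_to_K]
  rw [← RCLike.ofReal_re (K := ℂ) (∫ x, ‖u x‖ ^ 2 ∂μ), ← integral_ofReal]
  norm_cast

theorem IsParsevalFrameL2.isOrthonormalBasisL2 {ι : Type*} {u : ι → α → ℂ}
    (hu : IsParsevalFrameL2 u μ) (h1 : ∀ i, (eLpNorm (u i) 2 μ).toReal = 1) :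
    IsOrthonormalBasisL2 u μ := by
  obtain ⟨hu2, hP⟩ := hu
  exact ⟨hu2, hP.isOrthonormalBasis fun i => by rw [Lp.norm_toLp, h1]⟩

end LTwo

/-! ### Transport of square-integrable functions to an equivalent density -/

section Density

variable {β : Type*} [MeasurableSpace β] {ν ρ : Measure β}

/-- The square root of the density of `ν` with respect to `ρ`. -/
noncomputable def sqrtDensity (ν ρ : Measure β) (x : β) : ℝ := Real.sqrt (ν.rnDeriv ρ x).toReal

theorem measurable_sqrtDensity : Measurable (sqrtDensity ν ρ) :=
  (Measure.measurable_rnDeriv ν ρ).ennreal_toReal.sqrt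

theorem sqrtDensity_mul_self (x : β) :
    sqrtDensity ν ρ x * sqrtDensity ν ρ x = (ν.rnDeriv ρ x).toReal :=
  Real.mul_self_sqrt ENNReal.toReal_nonneg

/-- Also valid at `r = 0`, where both conventions give `0`; zeros of the density therefore need no
separate treatment. -/
theorem rpow_neg_half_eq_inv_sqrt {r : ℝ} (hr : 0 ≤ r) :
    r ^ (-(1 / 2) : ℝ) = (Real.sqrt r)⁻¹ := by
  rw [Real.rpow_neg hr, Real.sqrt_eq_rpow]

variable [SigmaFinite ν] [SigmaFinite ρ]

/-- The density integrates to `ν Cᶜ = 0` over `Cᶜ`. This lets integrals over `C` and over the whole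
space be exchanged. -/
theorem sqrtDensity_eq_zero_of_null_compl (hνρ : ν ≪ ρ) {C : Set β} (hC : MeasurableSet C)
    (hνC : ν Cᶜ = 0) : ∀ᵐ x ∂ρ, x ∉ C → sqrtDensity ν ρ x = 0 := by
  have h := Measure.setLIntegral_rnDeriv hνρ Cᶜ
  rw [hνC, setLIntegral_eq_zero_iff hC.compl (Measure.measurable_rnDeriv ν ρ)] at h
  filter_upwards [h] with x hx hxC
  simp [sqrtDensity, hx hxC]

theorem memLp_sqrtDensity_mul (hνρ : ν ≪ ρ) {K : β → ℂ} (hK : StronglyMeasurable K)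
    (hK2 : MemLp K 2 ν) : MemLp (fun x => (sqrtDensity ν ρ x : ℂ) * K x) 2 ρ := by
  have hm : AEStronglyMeasurable (fun x => (sqrtDensity ν ρ x : ℂ) * K x) ρ :=
    ((Complex.measurable_ofReal.comp measurable_sqrtDensity).mul
      hK.measurable).aestronglyMeasurable
  rw [memLp_two_iff_integrable_sq_norm hm]
  rw [memLp_two_iff_integrable_sq_norm hK2.1, ← integrable_rnDeriv_smul_iff hνρ] at hK2
  refine hK2.congr (.of_forall fun x => ?_)
  simp only [norm_mul, mul_pow, Complex.norm_real, Real.norm_eq_abs, sq_abs, smul_eq_mul]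
  rw [sq (sqrtDensity ν ρ x), sqrtDensity_mul_self]

/-- Multiplication by `w = sqrtDensity ν ρ` is isometric from `L²(ν)` to `L²(ρ)`, because `dν = w²
dρ`. -/
theorem integral_norm_sq_sqrtDensity_mul (hνρ : ν ≪ ρ) (K : β → ℂ) :
    ∫ x, ‖(sqrtDensity ν ρ x : ℂ) * K x‖ ^ 2 ∂ρ = ∫ x, ‖K x‖ ^ 2 ∂ν := by
  rw [← integral_rnDeriv_smul hνρ]
  refine integral_congr_ae (.of_forall fun x => ?_)
  simp only [norm_mul, mul_pow, Complex.norm_real, Real.norm_eq_abs, sq_abs, smul_eq_mul]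
  rw [sq (sqrtDensity ν ρ x), sqrtDensity_mul_self]

/-- Pointwise `w² · w⁻¹ = w`, including at `w = 0` since `0⁻¹ = 0`; no integrability is needed. -/
theorem integral_inner_mul_inv_sqrtDensity (hνρ : ν ≪ ρ) (K v : β → ℂ) :
    ∫ x, inner ℂ (K x) (v x * ((sqrtDensity ν ρ x)⁻¹ : ℝ)) ∂ν =
      ∫ x, inner ℂ ((sqrtDensity ν ρ x : ℂ) * K x) (v x) ∂ρ := by
  rw [← integral_rnDeriv_smul hνρ]
  refine integral_congr_ae (.of_forall fun x => ?_)
  simp only [RCLike.inner_apply, Complex.real_smul, map_mul, Complex.conj_ofReal]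
  rw [← sqrtDensity_mul_self]
  by_cases h : (sqrtDensity ν ρ x : ℂ) = 0
  · simp [h]
  · push_cast
    field_simp

/-- The integrand `w² · |w⁻¹|²` is at most the indicator of `C`, so the squared norm is bounded by
`ρ C`. This gives the square integrability of `f`. -/
theorem memLp_inv_sqrtDensity (hνρ : ν ≪ ρ) {C : Set β} (hC : MeasurableSet C)
    (hρC : ρ C ≠ ⊤) (hνC : ν Cᶜ = 0) :
    MemLp (fun x => (((sqrtDensity ν ρ x)⁻¹ : ℝ) : ℂ)) 2 ν := by
  have hm : Measurable (fun x => (((sqrtDensity ν ρ x)⁻¹ : ℝ) : ℂ)) :=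
    Complex.measurable_ofReal.comp measurable_sqrtDensity.inv
  rw [memLp_two_iff_integrable_sq_norm hm.aestronglyMeasurable,
    ← integrable_rnDeriv_smul_iff hνρ]
  have hi : Integrable (C.indicator fun _ => (1 : ℝ)) ρ :=
    (integrable_indicator_iff hC).mpr (integrableOn_const hρC)
  refine hi.mono' ((Measure.measurable_rnDeriv ν ρ).ennreal_toReal.smul
    (hm.norm.pow_const 2)).aestronglyMeasurable ?_
  filter_upwards [sqrtDensity_eq_zero_of_null_compl hνρ hC hνC] with x hx
  rw [← sqrtDensity_mul_self]
  by_cases hxC : x ∈ C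
  · rw [Set.indicator_of_mem hxC]
    by_cases h : sqrtDensity ν ρ x = 0
    · simp [h]
    · have : |sqrtDensity ν ρ x| ≠ 0 := by simpa using h
      refine le_of_eq ?_
      simp only [Complex.ofReal_inv, norm_inv, Complex.norm_real, Real.norm_eq_abs, smul_eq_mul,
        abs_mul, abs_pow, abs_inv, abs_abs]
      field_simp
  · simp [hx hxC, hxC]

/-- A Parseval frame on `C` gives, after division by the square root of the density of `ν`, a
Parseval frame for `ν`. -/
theorem hasSum_norm_sq_integral_density (hνρ : ν ≪ ρ) {C : Set β} (hC : MeasurableSet C)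
    (hνC : ν Cᶜ = 0) {ι : Type*} {v : ι → β → ℂ} (hv : IsParsevalFrameL2 v (ρ.restrict C))
    {K : β → ℂ} (hK : StronglyMeasurable K) (hK2 : MemLp K 2 ν) :
    HasSum (fun i => ‖∫ x, inner ℂ (K x) (v i x * ((sqrtDensity ν ρ x)⁻¹ : ℝ)) ∂ν‖ ^ 2)
      (∫ x, ‖K x‖ ^ 2 ∂ν) := by
  obtain ⟨hv2, hP⟩ := hv
  have hg := (memLp_sqrtDensity_mul hνρ hK hK2).restrict C
  have h0 := sqrtDensity_eq_zero_of_null_compl hνρ hC hνC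
  have h := hP (hg.toLp _)
  rw [norm_sq_toLp_eq_integral, setIntegral_eq_integral_of_ae_compl_eq_zero,
    integral_norm_sq_sqrtDensity_mul hνρ] at h
  · convert h using 3 with i
    rw [inner_toLp_eq_integral, integral_inner_mul_inv_sqrtDensity hνρ,
      setIntegral_eq_integral_of_ae_compl_eq_zero]
    filter_upwards [h0] with x hx hxC
    simp [hx hxC]
  · filter_upwards [h0] with x hx hxC
    simp [hx hxC]

end Density

/-! ### Transport along a chart -/

section Chart

variable {α β : Type*} [TopologicalSpace α] [MeasurableSpace α] [BorelSpace α]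
  [TopologicalSpace β] [MeasurableSpace β] [BorelSpace β] {μ : Measure α}
  {ψ : OpenPartialHomeomorph α β}

theorem aemeasurable_chart (μ : Measure α) (ψ : OpenPartialHomeomorph α β) :
    AEMeasurable ψ (μ.restrict ψ.source) :=
  ψ.continuousOn.aemeasurable ψ.open_source.measurableSet

theorem map_restrict_null_compl (μ : Measure α) (ψ : OpenPartialHomeomorph α β) {C : Set β}
    (hC : MeasurableSet C) (hψC : ψ.target ⊆ C) : ((μ.restrict ψ.source).map ψ) Cᶜ = 0 := by
  rw [Measure.map_apply_of_aemeasurable (aemeasurable_chart μ ψ) hC.compl,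
    Measure.restrict_apply' ψ.open_source.measurableSet]
  convert measure_empty (μ := μ)
  ext x
  simp only [Set.mem_inter_iff, Set.mem_preimage, Set.mem_compl_iff, Set.mem_empty_iff_false,
    iff_false, not_and]
  exact fun h hx => h (hψC (ψ.map_source hx))

theorem aemeasurable_chart_symm (μ : Measure α) (ψ : OpenPartialHomeomorph α β) :
    AEMeasurable ψ.symm ((μ.restrict ψ.source).map ψ) := by
  have h := ψ.continuousOn_symm.aemeasurable (μ := (μ.restrict ψ.source).map ψ)
    ψ.open_target.measurableSet
  rwa [Measure.restrict_eq_self_of_ae_mem] at h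
  exact mem_ae_iff.mpr (map_restrict_null_compl μ ψ ψ.open_target.measurableSet subset_rfl)

theorem map_symm_map_restrict (μ : Measure α) (ψ : OpenPartialHomeomorph α β) :
    ((μ.restrict ψ.source).map ψ).map ψ.symm = μ.restrict ψ.source := by
  rw [AEMeasurable.map_map_of_aemeasurable (aemeasurable_chart_symm μ ψ) (aemeasurable_chart μ ψ)]
  conv_rhs => rw [← Measure.map_id (μ := μ.restrict ψ.source)]
  refine Measure.map_congr ?_
  filter_upwards [ae_restrict_mem ψ.open_source.measurableSet] with x hx
  exact ψ.left_inv hx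

/-- Push-forwards can lose σ-finiteness; here pushing back along `ψ.symm` recovers the σ-finite
`μ.restrict ψ.source`. -/
instance sigmaFinite_map_restrict [SigmaFinite μ] :
    SigmaFinite ((μ.restrict ψ.source).map ψ) :=
  SigmaFinite.of_map _ (aemeasurable_chart_symm μ ψ) (by
    rw [map_symm_map_restrict]
    infer_instance)

theorem exists_stronglyMeasurable_comp_chart {g : α → ℂ} (hg : AEStronglyMeasurable g μ) :
    ∃ K : β → ℂ, StronglyMeasurable K ∧ g =ᵐ[μ.restrict ψ.source] K ∘ ψ := by
  have hg' : AEStronglyMeasurable g (((μ.restrict ψ.source).map ψ).map ψ.symm) := by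
    rw [map_symm_map_restrict]
    exact hg.restrict
  have h := hg'.comp_aemeasurable (aemeasurable_chart_symm μ ψ)
  refine ⟨h.mk _, h.stronglyMeasurable_mk, ?_⟩
  filter_upwards [ae_of_ae_map (aemeasurable_chart μ ψ) h.ae_eq_mk,
    ae_restrict_mem ψ.open_source.measurableSet] with x hx hxs
  simpa [ψ.left_inv hxs] using hx

variable {ρ : Measure β} [SigmaFinite ρ] [SigmaFinite μ]

theorem memLp_indicator_inv_sqrtDensity (hψ : (μ.restrict ψ.source).map ψ ≪ ρ)
    {C : Set β} (hC : MeasurableSet C) (hψC : ψ.target ⊆ C) (hρC : ρ C ≠ ⊤) :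
    MemLp (ψ.source.indicator fun x =>
      (((sqrtDensity ((μ.restrict ψ.source).map ψ) ρ (ψ x))⁻¹ : ℝ) : ℂ)) 2 μ := by
  rw [memLp_indicator_iff_restrict ψ.open_source.measurableSet]
  exact (memLp_inv_sqrtDensity hψ hC hρC
    (map_restrict_null_compl μ ψ hC hψC)).comp_of_map (aemeasurable_chart μ ψ)

theorem hasSum_norm_sq_integral_chart (hψ : (μ.restrict ψ.source).map ψ ≪ ρ)
    {C : Set β} (hC : MeasurableSet C) (hψC : ψ.target ⊆ C) {ι : Type*} {v : ι → β → ℂ}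
    (hv : IsParsevalFrameL2 v (ρ.restrict C)) {g : α → ℂ} (hg : MemLp g 2 μ) :
    HasSum (fun i => ‖∫ x in ψ.source, inner ℂ (g x) (v i (ψ x) *
        ((sqrtDensity ((μ.restrict ψ.source).map ψ) ρ (ψ x))⁻¹ : ℝ)) ∂μ‖ ^ 2)
      (∫ x in ψ.source, ‖g x‖ ^ 2 ∂μ) := by
  obtain ⟨K, hK, hgK⟩ := exists_stronglyMeasurable_comp_chart (ψ := ψ) hg.1
  have hT := aemeasurable_chart μ ψ
  have hνC := map_restrict_null_compl μ ψ hC hψC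
  have hK2 : MemLp K 2 ((μ.restrict ψ.source).map ψ) := by
    rw [memLp_map_measure_iff hK.aestronglyMeasurable hT]
    exact (memLp_congr_ae hgK).mp (hg.restrict _)
  -- The `v i` are only known to be measurable modulo null sets of `ρ.restrict C`; this carries that
  -- over to `ν`.
  have hνC' : (μ.restrict ψ.source).map ψ ≪ ρ.restrict C := by
    conv_lhs => rw [← Measure.restrict_eq_self_of_ae_mem (mem_ae_iff.mpr hνC)]
    exact hψ.restrict C
  convert hasSum_norm_sq_integral_density hψ hC hνC hv hK hK2 using 1
  · funext i
    rw [integral_map hT]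
    · congr 2
      refine integral_congr_ae ?_
      filter_upwards [hgK] with x hx
      simp [hx]
    · refine hK.aestronglyMeasurable.inner (((hv.1 i).1.mono_ac hνC').mul ?_)
      exact (Complex.measurable_ofReal.comp measurable_sqrtDensity.inv).aestronglyMeasurable
  · rw [integral_map hT (hK.norm.measurable.pow_const 2).aestronglyMeasurable]
    refine integral_congr_ae ?_
    filter_upwards [hgK] with x hx
    simp [hx]

end Chart

/-! ### Tilings -/

section Tiling

variable {K : Type*} [TopologicalSpace K] [Group K] [IsTopologicalGroup K] [MeasurableSpace K]
  [BorelSpace K] {μ : Measure K} [μ.IsMulLeftInvariant]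

/-- Countable additivity over tiles with null overlaps; left invariance moves each tile back to `U`.
-/
theorem hasSum_setIntegral_of_tiles {Γ U : Set K} (hΓ : Γ.Countable) (hU : IsOpen U)
    (hT : Tiles μ Γ U) {u : K → ℝ} (hu : Integrable u μ) :
    HasSum (fun ℓ : Γ => ∫ x in U, u ((ℓ : K)⁻¹ * x) ∂μ) (∫ x, u x ∂μ) := by
  have : Countable Γ := hΓ.to_subtype
  have h := hasSum_integral_iUnion_ae (μ := μ) (f := u)
    (s := fun ℓ : Γ => (fun h => (ℓ : K)⁻¹ * h) '' U)
    (fun ℓ => (isOpenMap_mul_left _ U hU).measurableSet.nullMeasurableSet)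
    (fun a b hab => hT.1 a.2 b.2 (Subtype.coe_injective.ne hab)) hu.integrableOn
  have hres : μ.restrict (⋃ ℓ : Γ, (fun h => (ℓ : K)⁻¹ * h) '' U) = μ := by
    refine Measure.restrict_eq_self_of_ae_mem (mem_ae_iff.mpr ?_)
    have := hT.2
    rwa [Set.biUnion_eq_iUnion] at this
  rw [hres] at h
  simpa only [fun ℓ : Γ => (measurePreserving_mul_left μ (ℓ : K)⁻¹).setIntegral_image_emb
    (measurableEmbedding_mulLeft _) u U] using h

/-- If the functions `B i` form a Parseval frame for the part of `L²(μ)` that lives on `U` and the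
translates of `U` tile the group, then the translates of the `B i` form a Parseval frame. -/
theorem isParsevalFrameL2_of_tiles {Γ U : Set K} (hΓ : Γ.Countable) (hU : IsOpen U)
    (hT : Tiles μ Γ U) {ι : Type*} {B : ι → K → ℂ} (hB : ∀ i, MemLp (B i) 2 μ)
    (hP : ∀ g : K → ℂ, MemLp g 2 μ →
      HasSum (fun i => ‖∫ x, inner ℂ (g x) (B i x) ∂μ‖ ^ 2) (∫ x in U, ‖g x‖ ^ 2 ∂μ)) :
    IsParsevalFrameL2 (fun (p : Γ × ι) h => B p.2 ((p.1 : K) * h)) μ := by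
  refine ⟨fun p => (hB p.2).comp_measurePreserving (measurePreserving_mul_left μ (p.1 : K)),
    fun g => ?_⟩
  have hg : MemLp g 2 μ := Lp.memLp g
  have hgi : Integrable (fun x => ‖g x‖ ^ 2) μ := (memLp_two_iff_integrable_sq_norm hg.1).mp hg
  have hg' : ‖g‖ ^ 2 = ∫ x, ‖g x‖ ^ 2 ∂μ := by
    rw [← norm_sq_toLp_eq_integral hg, Lp.toLp_coeFn]
  rw [hg']
  refine hasSum_prod_of_nonneg (fun p => by positivity) (fun ℓ => ?_)
    (hasSum_setIntegral_of_tiles hΓ hU hT hgi)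
  have h := hP (fun x => g ((ℓ : K)⁻¹ * x))
    (hg.comp_measurePreserving (measurePreserving_mul_left μ (ℓ : K)⁻¹))
  convert h using 3 with i
  conv_lhs => rw [← Lp.toLp_coeFn g hg]
  -- The substitution `h ↦ ℓ⁻¹ h` moves the translation from `B i` onto `g`.
  rw [inner_toLp_eq_integral, ← integral_mul_left_eq_self _ (ℓ : K)⁻¹]
  simp

end Tiling

/-! ### The group `G = NH` -/

section Group

variable {EN EH : Type*} [NormedAddCommGroup EN] [NormedSpace ℝ EN]
  [NormedAddCommGroup EH] {G : Type*} [TopologicalSpace G] [Group G]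
  {N H : Subgroup G} [N.Normal] [ChartedSpace EN N]

/-- A functional is determined on `𝔭` by its values at the `X_j`, `j ∈ J`. Hence `Γ_N ⊆ exp 𝔭`: only
there does `P^* β_lam` carry the full phase. -/
theorem dualVec_dualCoord_proj {n : ℕ} {V : Type*} [AddCommGroup V] [Module ℝ V]
    (X : Module.Basis (Fin n) ℝ V) (J : Finset (Fin n)) (η : Module.Dual ℝ V) {Y : V}
    (hY : Y ∈ LinearMap.range (proj X J)) :
    dualVec X J (dualCoord X J ((proj X J).dualMap η)) Y = η Y := by
  obtain ⟨Z, rfl⟩ := hY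
  have hp : ∀ k, proj X J (X k) = if k ∈ J then X k else 0 := fun k => by
    simp [proj]
  have h : dualVec X J (dualCoord X J ((proj X J).dualMap η)) ∘ₗ proj X J = η ∘ₗ proj X J := by
    refine X.ext fun k => ?_
    simp only [LinearMap.comp_apply, hp]
    split_ifs with hk
    · simp only [dualVec, dualCoord, LinearMap.dualMap_apply, LinearMap.coe_sum,
        Finset.sum_apply, LinearMap.smul_apply, Module.Basis.coord_apply, Module.Basis.repr_self,
        hp, smul_eq_mul]
      rw [Finset.sum_eq_single ⟨k, hk⟩]
      · simp [hk]
      · intro j _ hj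
        rw [Finsupp.single_eq_of_ne, mul_zero]
        exact fun h => hj (Subtype.ext h)
      · simp
    · simp
  exact LinearMap.congr_fun h Z

theorem frameSystem_apply {n : ℕ} (hG : Subgroup.IsComplement' N H)
    (lam : Module.Dual ℝ (GroupLieAlgebra 𝓘(ℝ, EN) N)) {J : Finset (Fin n)} (C : Set (J → ℝ))
    (ΓH : Set H) (ΓN : Set N) (f : H → ℂ) (p : ΓH × ΓN) (h : H) :
    frameSystem hG lam C ΓH ΓN f p h =
      piN lam (p.2 : N) (fun h => (((volume.real C) ^ (-(1 / 2) : ℝ) : ℝ) : ℂ) * f h)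
        ((p.1 : H) * h) := by
  -- The product `ℓ⁻¹ κ` is already in the `HN` order used by `indRep`, so these are its factors.
  have he : hG.symm.equiv (((p.1 : H)⁻¹ : H) * ((p.2 : N) : G)) = ((p.1 : H)⁻¹, (p.2 : N)) := by
    rw [← Equiv.eq_symm_apply, Subgroup.IsComplement.equiv_symm_apply]
  simp only [frameSystem, indRep, piH]
  rw [he]
  simp

theorem norm_piN (lam : Module.Dual ℝ (GroupLieAlgebra 𝓘(ℝ, EN) N)) (x : N) (f : H → ℂ) (h : H) :
    ‖piN lam x f h‖ = ‖f h‖ := by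
  rw [piN, norm_mul]
  have : (2 * Real.pi * Complex.I * (beta lam h (lieLog x) : ℝ) : ℂ) =
      ((2 * Real.pi * beta lam h (lieLog x) : ℝ) : ℂ) * Complex.I := by
    push_cast
    ring
  rw [this, Complex.norm_exp_ofReal_mul_I, one_mul]

variable {n : ℕ} {lam : Module.Dual ℝ (GroupLieAlgebra 𝓘(ℝ, EN) N)}
  {X : Module.Basis (Fin n) ℝ (GroupLieAlgebra 𝓘(ℝ, EN) N)} {J : Finset (Fin n)}
  {φ : OpenPartialHomeomorph H EH}

theorem window_eq_indicator [MeasurableSpace G] [BorelSpace G] (μ : Measure H)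
    {ψ : OpenPartialHomeomorph H (J → ℝ)} (hs : ψ.source = φ.source)
    (hψ : ∀ h ∈ φ.source, ψ h = Theta lam X J φ (φ h)) :
    window μ lam X J φ = ψ.source.indicator (fun h =>
      (((sqrtDensity ((μ.restrict ψ.source).map ψ) volume (ψ h))⁻¹ : ℝ) : ℂ)) := by
  have hmap : (μ.restrict φ.source).map (fun h => Theta lam X J φ (φ h)) =
      (μ.restrict ψ.source).map ψ := by
    rw [hs]
    refine Measure.map_congr ?_
    filter_upwards [ae_restrict_mem φ.open_source.measurableSet] with h hh
    exact (hψ h hh).symm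
  funext h
  rw [window, hs]
  by_cases hh : h ∈ φ.source
  · rw [Set.indicator_of_mem hh, Set.indicator_of_mem hh, W, hmap, ← hψ h hh,
      rpow_neg_half_eq_inv_sqrt ENNReal.toReal_nonneg, sqrtDensity, hs]
  · rw [Set.indicator_of_notMem hh, Set.indicator_of_notMem hh]

/-- On `𝒪`, modulation by `κ ∈ exp 𝔭` is the pull-back of a trigonometric function under
`Θ_lam ∘ φ`. -/
theorem piN_eq_trigSystem {C : Set (J → ℝ)} {ΓN : Set N} (κ : ΓN)
    (hκ : (lieLog (κ : N) : GroupLieAlgebra 𝓘(ℝ, EN) N) ∈ LinearMap.range (proj X J))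
    (f : H → ℂ) {h : H} (hh : h ∈ φ.source) :
    piN lam (κ : N) (fun h => (((volume.real C) ^ (-(1 / 2) : ℝ) : ℝ) : ℂ) * f h) h =
      trigSystem X J C ΓN κ (Theta lam X J φ (φ h)) * f h := by
  rw [piN, trigSystem, Theta, φ.left_inv hh, dualVec_dualCoord_proj X J _ hκ,
    rpow_neg_half_eq_inv_sqrt measureReal_nonneg]
  push_cast
  ring

/-- `Θ_lam ∘ φ` as a smooth chart of `H` with values in `ℝ^J`. -/
theorem exists_chart_Theta [NormedSpace ℝ EH] [ChartedSpace EH H] [LieGroup 𝓘(ℝ, EH) ∞ H]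
    (hφ : φ ∈ IsManifold.maximalAtlas 𝓘(ℝ, EH) ∞ H)
    (hTheta : IsDiffeoOn (Theta lam X J φ) φ.target) :
    ∃ ψ : OpenPartialHomeomorph H (J → ℝ), ψ.source = φ.source ∧
      (∀ h ∈ φ.source, ψ h = Theta lam X J φ (φ h)) ∧
      ψ.target = Theta lam X J φ '' φ.target ∧
      ContMDiffOn 𝓘(ℝ, EH) 𝓘(ℝ, J → ℝ) ∞ ψ ψ.source ∧
      ContMDiffOn 𝓘(ℝ, J → ℝ) 𝓘(ℝ, EH) ∞ ψ.symm ψ.target := by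
  obtain ⟨e, hes, heq, he, he'⟩ := hTheta
  have hs : (φ.trans e).source = φ.source := by
    rw [OpenPartialHomeomorph.trans_source, hes]
    exact Set.inter_eq_left.mpr fun x hx => φ.map_source hx
  have ht : (φ.trans e).target = e.target := by
    rw [OpenPartialHomeomorph.trans_target, ← hes]
    exact Set.inter_eq_left.mpr fun x hx => e.map_target hx
  refine ⟨φ.trans e, hs, fun h hh => heq (φ.map_source hh), ?_, ?_, ?_⟩
  · rw [ht, ← e.image_source_eq_target, hes, heq.image_eq]
  · rw [hs]
    exact he.contMDiffOn.comp (contMDiffOn_of_mem_maximalAtlas hφ) fun x hx =>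
      hes.ge (φ.map_source hx)
  · rw [ht]
    exact (contMDiffOn_symm_of_mem_maximalAtlas hφ).comp he'.contMDiffOn fun x hx =>
      hes.le (e.map_target hx)

end Group

end LieFrame

theorem mainTheorem4
    {EG EN EH : Type*} [NormedAddCommGroup EG] [NormedSpace ℝ EG] [FiniteDimensional ℝ EG]
    [NormedAddCommGroup EN] [NormedSpace ℝ EN] [FiniteDimensional ℝ EN] [CompleteSpace EN]
    [NormedAddCommGroup EH] [NormedSpace ℝ EH] [FiniteDimensional ℝ EH]
    -- the Lie group `G`
    {G : Type*} [TopologicalSpace G] [T2Space G] [SecondCountableTopology G] [ChartedSpace EG G]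
    [Group G] [LieGroup 𝓘(ℝ, EG) ∞ G] [MeasurableSpace G] [BorelSpace G]
    -- the closed connected subgroups `N` (normal, exponential solvable) and `H`, with `G = NH`
    (N H : Subgroup G) [N.Normal]
    [ChartedSpace EN N] [LieGroup 𝓘(ℝ, EN) ∞ N] [ChartedSpace EH H] [LieGroup 𝓘(ℝ, EH) ∞ H]
    (hN : LieFrame.IsClosedLieSubgroup EG EN N) (hH : LieFrame.IsClosedLieSubgroup EG EH H)
    [ConnectedSpace H] (hNexp : LieFrame.IsExponentialSolvable EN N)
    (hG : Subgroup.IsComplement' N H)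
    -- the left Haar measure of `H`
    (μ : Measure H) [μ.IsHaarMeasure]
    -- the functional `lam`, vanishing on `[𝔫, 𝔫]`
    (lam : Module.Dual ℝ (GroupLieAlgebra 𝓘(ℝ, EN) N))
    (hlam : ∀ Y Z : GroupLieAlgebra 𝓘(ℝ, EN) N, lam ⁅Y, Z⁆ = 0)
    -- the basis of `𝔫`, the index set `J`, the chart `(𝒪, φ)` of `H` around the identity
    {n : ℕ} (X : Module.Basis (Fin n) ℝ (GroupLieAlgebra 𝓘(ℝ, EN) N)) (J : Finset (Fin n))
    (φ : OpenPartialHomeomorph H EH) (hφ : φ ∈ IsManifold.maximalAtlas 𝓘(ℝ, EH) ∞ H)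
    (hφ1 : (1 : H) ∈ φ.source) (hφ0 : φ 1 = 0)
    (hTheta : LieFrame.IsDiffeoOn (LieFrame.Theta lam X J φ) φ.target)
    -- the set `C` and the discrete set `Γ_N ⊆ exp 𝔭`
    (C : Set (J → ℝ)) (hC : IsCompact C) (hTC : LieFrame.Theta lam X J φ '' φ.target ⊆ C)
    (ΓN : Set N) (hΓNd : IsDiscrete ΓN)
    (hΓNp : ΓN ⊆ LieFrame.lieExp '' (LinearMap.range (LieFrame.proj X J) :
      Set (GroupLieAlgebra 𝓘(ℝ, EN) N)))
    (hΓN : LieFrame.IsOrthonormalBasisL2 (LieFrame.trigSystem X J C ΓN) (volume.restrict C))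
    -- the discrete set `Γ_H` with `{ℓ⁻¹ 𝒪 : ℓ ∈ Γ_H}` a tiling of `H`
    (ΓH : Set H) (hΓHd : IsDiscrete ΓH) (hΓH : LieFrame.Tiles μ ΓH φ.source)
    -- the function `f`
    (f : H → ℂ) (hf : f =ᵐ[μ] LieFrame.window μ lam X J φ) :
    MemLp f 2 μ ∧
    LieFrame.IsParsevalFrameL2 (LieFrame.frameSystem hG lam C ΓH ΓN f) μ ∧
    ((eLpNorm f 2 μ).toReal = Real.sqrt (volume.real C) →
      LieFrame.IsOrthonormalBasisL2 (LieFrame.frameSystem hG lam C ΓH ΓN f) μ) := by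
  have : IsTopologicalGroup H := topologicalGroup_of_lieGroup 𝓘(ℝ, EH) ∞
  have : SecondCountableTopology H :=
    TopologicalSpace.Subtype.secondCountableTopology (H : Set G)
  have : LocallyCompactSpace H := Manifold.locallyCompact_of_finiteDimensional 𝓘(ℝ, EH)
  obtain ⟨ψ, hs, hψ, ht, hsm, hsm'⟩ := LieFrame.exists_chart_Theta hφ hTheta
  have hac := LieFrame.map_restrict_absolutelyContinuous volume μ ψ hsm hsm'
  have hψC : ψ.target ⊆ C := ht ▸ hTC
  rw [LieFrame.window_eq_indicator μ hs hψ] at hf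
  have hf2 : MemLp f 2 μ := (memLp_congr_ae hf).mpr
    (LieFrame.memLp_indicator_inv_sqrtDensity hac hC.measurableSet hψC hC.measure_ne_top)
  have hCpos : 0 < volume.real C := by
    refine ENNReal.toReal_pos ?_ hC.measure_ne_top
    refine ((ψ.open_target.measure_pos volume ⟨ψ 1, ψ.map_source (hs ▸ hφ1)⟩).trans_le
      (measure_mono hψC)).ne'
  have hlog : ∀ κ : ΓN, (LieFrame.lieLog (κ : N) : GroupLieAlgebra 𝓘(ℝ, EN) N) ∈
      LinearMap.range (LieFrame.proj X J) := by
    intro κ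
    obtain ⟨Y, hY, hYκ⟩ := hΓNp κ.2
    rw [← hYκ, LieFrame.lieLog, Function.leftInverse_invFun hNexp.bijective.1]
    exact hY
  have hvP : LieFrame.IsParsevalFrameL2 (LieFrame.trigSystem X J C ΓN) (volume.restrict C) :=
    ⟨hΓN.1, hΓN.2.isParsevalFrame⟩
  obtain ⟨c, hc⟩ : ∃ c : ℂ, c = (((volume.real C) ^ (-(1 / 2) : ℝ) : ℝ) : ℂ) := ⟨_, rfl⟩
  obtain ⟨B, hBdef⟩ : ∃ B : ΓN → H → ℂ, B = fun κ : ΓN =>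
    LieFrame.piN lam (κ : N) (fun h => c * f h) := ⟨_, rfl⟩
  -- Off `𝒪` the phase need not be trigonometric in `ψ`, but there `f` vanishes almost everywhere.
  have hBae : ∀ κ, B κ =ᵐ[μ] ψ.source.indicator (fun h => LieFrame.trigSystem X J C ΓN κ (ψ h) *
      ((LieFrame.sqrtDensity ((μ.restrict ψ.source).map ψ) volume (ψ h))⁻¹ : ℝ)) := by
    intro κ
    filter_upwards [hf] with h hh
    by_cases hhs : h ∈ φ.source
    · have hhs' : h ∈ ψ.source := hs ▸ hhs
      rw [Set.indicator_of_mem hhs'] at hh ⊢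
      simp only [hBdef, hc]
      rw [LieFrame.piN_eq_trigSystem κ (hlog κ) f hhs, hh, hψ h hhs]
    · have hhs' : h ∉ ψ.source := hs ▸ hhs
      rw [Set.indicator_of_notMem hhs'] at hh ⊢
      simp [hBdef, LieFrame.piN, hh]
  have hBnorm : ∀ κ h, ‖B κ h‖ = ‖c * f h‖ := fun κ h => by
    rw [hBdef]
    exact LieFrame.norm_piN lam _ _ h
  have hB : ∀ κ, MemLp (B κ) 2 μ := by
    intro κ
    refine (hf2.const_mul c).of_le ?_ (.of_forall fun h => (hBnorm κ h).le)
    -- Measurability is read off from the chart formula, which avoids studying `h ↦ Ad(h⁻¹)` on all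
    -- of `H`.
    refine AEStronglyMeasurable.congr ?_ (hBae κ).symm
    rw [aestronglyMeasurable_indicator_iff ψ.open_source.measurableSet]
    have htrig : Measurable (LieFrame.trigSystem X J C ΓN κ) := by
      have : Continuous (LieFrame.trigSystem X J C ΓN κ) := by
        unfold LieFrame.trigSystem LieFrame.dualVec
        simp only [LinearMap.sum_apply, LinearMap.smul_apply]
        fun_prop
      exact this.measurable
    exact ((htrig.mul (Complex.measurable_ofReal.comp
      LieFrame.measurable_sqrtDensity.inv)).comp_aemeasurable
        (LieFrame.aemeasurable_chart μ ψ)).aestronglyMeasurable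
  have hΓHc : ΓH.Countable := by
    have := hΓHd.to_subtype
    have : SecondCountableTopology ΓH := TopologicalSpace.Subtype.secondCountableTopology ΓH
    exact TopologicalSpace.separableSpace_iff_countable.mp inferInstance
  have hsys : LieFrame.frameSystem hG lam C ΓH ΓN f = fun p h => B p.2 ((p.1 : H) * h) := by
    funext p h
    rw [hBdef, hc]
    exact LieFrame.frameSystem_apply hG lam C ΓH ΓN f p h
  have hPar : LieFrame.IsParsevalFrameL2 (LieFrame.frameSystem hG lam C ΓH ΓN f) μ := by
    rw [hsys]
    refine LieFrame.isParsevalFrameL2_of_tiles hΓHc φ.open_source hΓH hB fun g hg => ?_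
    have h := LieFrame.hasSum_norm_sq_integral_chart hac hC.measurableSet hψC hvP hg
    rw [← hs]
    convert h using 3 with κ
    rw [← integral_indicator ψ.open_source.measurableSet]
    refine congrArg _ (integral_congr_ae ?_)
    filter_upwards [hBae κ] with x hx
    rw [hx]
    by_cases hxs : x ∈ ψ.source
    · simp only [Set.indicator_of_mem hxs]
    · simp only [Set.indicator_of_notMem hxs, inner_zero_right]
  refine ⟨hf2, hPar, fun hnorm => hPar.isOrthonormalBasisL2 fun p => ?_⟩
  have h1 : eLpNorm (fun h => B p.2 ((p.1 : H) * h)) 2 μ = eLpNorm (B p.2) 2 μ :=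
    eLpNorm_comp_measurePreserving (hB p.2).1 (measurePreserving_mul_left μ (p.1 : H))
  have h2 : eLpNorm (B p.2) 2 μ = eLpNorm (c • f) 2 μ :=
    eLpNorm_congr_norm_ae (.of_forall fun h => hBnorm p.2 h)
  -- Every vector has norm `|C|^{-1/2} ‖f‖ = 1`.
  rw [hsys, h1, h2, eLpNorm_const_smul, ENNReal.toReal_mul, hnorm, toReal_enorm, hc,
    LieFrame.rpow_neg_half_eq_inv_sqrt hCpos.le, Complex.norm_real,
    Real.norm_of_nonneg (by positivity)]
  exact inv_mul_cancel₀ (Real.sqrt_pos.mpr hCpos).ne'
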